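/- Let $k\ge 0$, let $(I,\mathscr I,\nu)$ be a probability space and let $\{T_i\}_{i\in I}$ be a family of maximal monotone operators $T_i:\mathbb R^k\to\mathcal P(\mathbb R^k)$; that is, $\langle x'-x,v'-v\rangle\ge 0$ whenever $v\in T_i(x)$ and $v'\in T_i(x')$, and the graph of $T_i$ is not properly contained in the graph of another monotone operator. Fix $\lambda>0$ and $\alpha\in(0,2)$, let $J_{\lambda T_i}=(\mathrm{Id}+\lambda T_i)^{-1}:\mathbb R^k\to\mathbb R^k$ be the (single-valued, everywhere defined) resolvent, and assume that $i\mapsto J_{\lambda T_i}(x)$ is measurable for every $x\in\mathbb R^k$. Let $(\xi_n)_{n\ge 0}$ be an ergodic stationary sequence of $I$-valued random variables with distribution $\nu$ on a probability space $(\Omega,\mathscr F,\mathbb P)$; that is, the law of $(\xi_n)_{n\ge0}$ on $I^{\mathbb N}$ is invariant and ergodic for the shift. Suppose that $$Z=\{x\in\mathbb R^k : 0\in T_i(x)\text{ for }\nu\text{-almost every } i\}$$ is non-empty. Then for every $x_0\in\mathbb R^k$ the functions $X_n:\Omega\to\mathbb R^k$ defined by $$X_0=x_0,\qquad X_{n+1}=X_n+\alpha\bigl(J_{\lambda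 T_{\xi_n}}(X_n)-X_n\bigr),\quad n\ge 0,$$ are random variables, and $(X_n)$ converges almost surely to a random variable $X$ with values in $Z$. -/

import Mathlib

open MeasureTheory Filter Topology

section Operators

variable {E : Type*} [NormedAddCommGroup E] [InnerProductSpace ℝ E]

/-- The graph of a set-valued operator `T`. -/
def opGraph (T : E → Set E) : Set (E × E) := {p | p.2 ∈ T p.1}

/-- The inverse of a set-valued operator: `x ∈ T⁻¹ v` if and only if `v ∈ T x`. -/
def opInverse (T : E → Set E) : E → Set E := fun v => {x | v ∈ T x}

/-- A set-valued operator is monotone if `⟪x' - x, v' - v⟫ ≥ 0` for all pairs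
`(x, v)`, `(x', v')` in its graph. -/
def IsMonotoneOp (T : E → Set E) : Prop :=
  ∀ p ∈ opGraph T, ∀ q ∈ opGraph T, 0 ≤ inner ℝ (q.1 - p.1) (q.2 - p.2)

/-- A monotone operator is maximal if its graph is not properly contained in the graph of
another monotone operator. -/
def IsMaximalMonotoneOp (T : E → Set E) : Prop :=
  IsMonotoneOp T ∧ ∀ S : E → Set E, IsMonotoneOp S → ¬ opGraph T ⊂ opGraph S

/-- The set-valued operator `Id + lam T`. -/
def idAddSMulOp (lam : ℝ) (T : E → Set E) : E → Set E :=
  fun x => {u | ∃ v ∈ T x, u = x + lam • v}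

/-- The resolvent `J_{lam T} = (Id + lam T)⁻¹` as a map: `resolventMap lam T u` is the element of
`(Id + lam T)⁻¹ u`. For `T` maximal monotone and `lam > 0` on `ℝᵏ` this set is always a singleton. -/
noncomputable def resolventMap (lam : ℝ) (T : E → Set E) (u : E) : E :=
  Classical.epsilon fun x => x ∈ opInverse (idAddSMulOp lam T) u

/-- The points `x` with `0 ∈ T i x` for `ν`-almost every `i`. -/
def aeCommonZeros {I : Type*} [MeasurableSpace I] (ν : Measure I) (T : I → E → Set E) : Set E :=
  {x | ∀ᵐ i ∂ν, (0 : E) ∈ T i x}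

end Operators

/-- The one-sided shift on sequences. -/
def seqShift {I : Type*} (w : ℕ → I) : ℕ → I := fun n => w (n + 1)

/-- `ξ` is an ergodic stationary sequence of random variables on `(Ω, P)`: the law of the whole
sequence on the product space `ℕ → I` is invariant and ergodic for the shift. -/
structure IsErgodicStationary {Ω I : Type*} [MeasurableSpace Ω] [MeasurableSpace I]
    (ξ : ℕ → Ω → I) (P : Measure Ω) : Prop where
  measurable : ∀ n, Measurable (ξ n)
  ergodic : Ergodic (seqShift (I := I)) (P.map fun ω n => ξ n ω)

/-! The resolvents are firmly nonexpansive, so the maps `R i = Id + α (J_{lam T i} - Id)` are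
nonexpansive, have the zeros of `T i` as fixed points, and bring every other point strictly closer
to each of these. Hence, almost surely, the distance from an orbit to a common zero `z` decreases
to a limit. A point that some `R (ξ n)` moves has a limiting distance to `z` strictly below its
present one, and by ergodicity a point that no `R (ξ n)` moves is a common zero. On a compact set
without common zeros the gap is bounded below by compactness, and Poincaré recurrence makes one
such lower bound valid for infinitely many shifts of the sequence, so no orbit stays in the set:
orbits come arbitrarily close to the common zeros, and Fejér monotonicity turns this into
convergence. -/

section Extension

variable {E F ι : Type*} [NormedAddCommGroup E] [InnerProductSpace ℝ E] [NormedAddCommGroup F]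
  [InnerProductSpace ℝ F] {c : ι → E} {d : ι → F}

theorem le_norm_sq_sub_norm_sq_of_mem_convexHull (h : ∀ i j, ‖c i - c j‖ ≤ ‖d i - d j‖)
    {p : E × F × ℝ} (hp : p ∈ convexHull ℝ (Set.range fun i => (c i, d i, ‖c i‖ ^ 2 - ‖d i‖ ^ 2))) :
    p.2.2 ≤ ‖p.1‖ ^ 2 - ‖p.2.1‖ ^ 2 := by
  -- The polarization of the claim is affine in each variable, so it suffices to test it on pairs
  -- of generators, where it is the assumption squared.
  let B (p q : E × F × ℝ) : ℝ :=
    p.2.2 - 2 * inner ℝ p.1 q.1 + 2 * inner ℝ p.2.1 q.2.1 + q.2.2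
  have B_comm (p q) : B p q = B q p := by
    simp only [B, real_inner_comm]
    ring
  have B_nonpos_of_generators (q : E × F × ℝ)
      (hq : ∀ i, B (c i, d i, ‖c i‖ ^ 2 - ‖d i‖ ^ 2) q ≤ 0) :
      ∀ p ∈ convexHull ℝ (Set.range fun i => (c i, d i, ‖c i‖ ^ 2 - ‖d i‖ ^ 2)), B p q ≤ 0 := by
    have hlin : IsLinearMap ℝ fun p : E × F × ℝ =>
        p.2.2 - 2 * inner ℝ p.1 q.1 + 2 * inner ℝ p.2.1 q.2.1 :=
      ⟨fun x y => by simp only [Prod.fst_add, Prod.snd_add, inner_add_left]; ring,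
        fun a x => by
          simp only [Prod.smul_fst, Prod.smul_snd, real_inner_smul_left, smul_eq_mul]; ring⟩
    intro p hp
    refine le_neg_iff_add_nonpos_right.1
      (convexHull_min ?_ (convex_halfSpace_le hlin (-q.2.2)) hp)
    rintro _ ⟨i, rfl⟩
    exact le_neg_iff_add_nonpos_right.2 (hq i)
  have hB_generators (i j) : B (c i, d i, ‖c i‖ ^ 2 - ‖d i‖ ^ 2) (c j, d j, ‖c j‖ ^ 2 - ‖d j‖ ^ 2)
      ≤ 0 := by
    have hsq := pow_le_pow_left₀ (norm_nonneg _) (h i j) 2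
    rw [norm_sub_sq_real, norm_sub_sq_real] at hsq
    simp only [B]
    linarith
  have hpp : B p p ≤ 0 :=
    B_nonpos_of_generators p
      (fun i => B_comm p _ ▸ B_nonpos_of_generators _ (fun j => hB_generators j i) p hp) p hp
  simp only [B, real_inner_self_eq_norm_sq] at hpp
  linarith

theorem exists_forall_norm_sub_le_of_finite [Finite ι] (h : ∀ i j, ‖c i - c j‖ ≤ ‖d i - d j‖) :
    ∃ x, ∀ i, ‖x - c i‖ ≤ ‖d i‖ := by
  cases isEmpty_or_nonempty ι
  · exact ⟨0, isEmptyElim⟩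
  let q (i : ι) : E × F × ℝ := (c i, d i, ‖c i‖ ^ 2 - ‖d i‖ ^ 2)
  -- The first component of a maximizer of `p.2.2 - ‖p.1‖ ^ 2` over the convex hull works: the
  -- maximal value is nonpositive, and moving towards a generator does not increase it.
  have hcompact : IsCompact (convexHull ℝ (Set.range q)) :=
    (Set.finite_range q).isCompact_convexHull ℝ
  obtain ⟨p, hp, hmax⟩ := hcompact.exists_isMaxOn (Set.range_nonempty q).convexHull
    (f := fun p => p.2.2 - ‖p.1‖ ^ 2) (by fun_prop)
  have hp_nonpos : p.2.2 - ‖p.1‖ ^ 2 ≤ 0 := by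
    linarith [le_norm_sq_sub_norm_sq_of_mem_convexHull h hp, sq_nonneg ‖p.2.1‖]
  refine ⟨p.1, fun j => ?_⟩
  have norm_sq_combo (t : ℝ) : ‖(1 - t) • p.1 + t • c j‖ ^ 2
      = (1 - t) * ‖p.1‖ ^ 2 + t * ‖c j‖ ^ 2 - t * (1 - t) * ‖p.1 - c j‖ ^ 2 := by
    rw [norm_add_sq_real, norm_sub_sq_real, real_inner_smul_left, real_inner_smul_right, norm_smul,
      norm_smul, mul_pow, mul_pow, Real.norm_eq_abs, Real.norm_eq_abs, sq_abs, sq_abs]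
    ring
  have hvariation : ∀ t ∈ Set.Ioo (0 : ℝ) 1, (1 - t) * ‖p.1 - c j‖ ^ 2 ≤ ‖d j‖ ^ 2 := by
    intro t ht
    have hmem : (1 - t) • p + t • q j ∈ convexHull ℝ (Set.range q) :=
      convex_convexHull ℝ _ hp (subset_convexHull ℝ _ ⟨j, rfl⟩) (by linarith [ht.2]) ht.1.le
        (by ring)
    have hle := isMaxOn_iff.1 hmax _ hmem
    simp only [q, Prod.fst_add, Prod.snd_add, Prod.smul_fst, Prod.smul_snd, smul_eq_mul,
      norm_sq_combo] at hle
    refine le_of_mul_le_mul_left ?_ ht.1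
    linarith [mul_nonpos_of_nonneg_of_nonpos ht.1.le hp_nonpos]
  have hlimit :
      Tendsto (fun t : ℝ => (1 - t) * ‖p.1 - c j‖ ^ 2) (𝓝[>] 0) (𝓝 (‖p.1 - c j‖ ^ 2)) := by
    have hcont : Continuous fun t : ℝ => (1 - t) * ‖p.1 - c j‖ ^ 2 := by fun_prop
    simpa using (hcont.tendsto 0).mono_left nhdsWithin_le_nhds
  have hsq : ‖p.1 - c j‖ ^ 2 ≤ ‖d j‖ ^ 2 :=
    le_of_tendsto hlimit (eventually_of_mem (Ioo_mem_nhdsGT one_pos) hvariation)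
  exact le_of_sq_le_sq hsq (norm_nonneg _)

/-- One-point extension for Kirszbraun's theorem. -/
theorem exists_forall_dist_le_dist [ProperSpace E]
    (h : ∀ i j, dist (c i) (c j) ≤ dist (d i) (d j)) (y : F) :
    ∃ x, ∀ i, dist x (c i) ≤ dist y (d i) := by
  classical
  rcases isEmpty_or_nonempty ι with _ | ⟨⟨i₀⟩⟩
  · exact ⟨0, isEmptyElim⟩
  have hfinite (s : Finset ι) :
      (Metric.closedBall (c i₀) (dist y (d i₀)) ∩
        ⋂ i ∈ s, Metric.closedBall (c i) (dist y (d i))).Nonempty := by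
    obtain ⟨x, hx⟩ := exists_forall_norm_sub_le_of_finite (ι := ↥(insert i₀ s))
      (c := fun i => c i) (d := fun i => y - d i) fun i j => by
        simpa [dist_eq_norm, norm_sub_rev] using h i j
    simp only [← dist_eq_norm] at hx
    exact ⟨x, hx ⟨i₀, Finset.mem_insert_self _ _⟩, Set.mem_iInter₂.2 fun i hi =>
      hx ⟨i, Finset.mem_insert_of_mem hi⟩⟩
  obtain ⟨x, -, hx⟩ := (isCompact_closedBall _ _).inter_iInter_nonempty _
    (fun _ => Metric.isClosed_closedBall) hfinite
  exact ⟨x, Set.mem_iInter.1 hx⟩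

end Extension

section Resolvent

variable {E : Type*} [NormedAddCommGroup E] [InnerProductSpace ℝ E] {T : E → Set E} {lam : ℝ}

theorem IsMaximalMonotoneOp.mem_of_forall_inner_nonneg (hT : IsMaximalMonotoneOp T) {x v : E}
    (h : ∀ p ∈ opGraph T, 0 ≤ inner ℝ (x - p.1) (v - p.2)) : v ∈ T x := by
  let S : E → Set E := fun y => {w | (y, w) ∈ insert (x, v) (opGraph T)}
  have hgraph : opGraph S = insert (x, v) (opGraph T) := rfl
  have hS : IsMonotoneOp S := by
    rw [IsMonotoneOp, hgraph]
    rintro p (rfl | hp) q (rfl | hq)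
    · simp
    · rw [← neg_sub x, ← neg_sub v, inner_neg_neg]
      exact h _ hq
    · exact h _ hp
    · exact hT.1 _ hp _ hq
  by_contra hv
  exact hT.2 S hS (hgraph ▸ Set.ssubset_insert hv)

theorem norm_add_le_norm_sub_iff_inner_nonpos {a b : E} : ‖a + b‖ ≤ ‖a - b‖ ↔ inner ℝ a b ≤ 0 := by
  rw [← sq_le_sq₀ (norm_nonneg _) (norm_nonneg _), norm_add_sq_real, norm_sub_sq_real]
  constructor <;> intro <;> linarith

theorem mem_opInverse_idAddSMulOp_iff (hlam : lam ≠ 0) {u x : E} :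
    x ∈ opInverse (idAddSMulOp lam T) u ↔ lam⁻¹ • (u - x) ∈ T x := by
  constructor
  · rintro ⟨v, hv, rfl⟩
    simpa [hlam] using hv
  · exact fun h => ⟨_, h, by simp [hlam]⟩

/-- Minty's theorem. Monotonicity of `T` says that `y - w ↦ y + w`, where `w = u - lam • v` and
`v ∈ T y`, is nonexpansive; the value of an extension to `0` is twice the resolvent of `u`. -/
theorem IsMaximalMonotoneOp.nonempty_opInverse_idAddSMulOp [ProperSpace E]
    (hT : IsMaximalMonotoneOp T) (hlam : 0 < lam) (u : E) :
    (opInverse (idAddSMulOp lam T) u).Nonempty := by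
  let w (p : opGraph T) : E := u - lam • p.1.2
  have hnonexpansive (p q : opGraph T) :
      dist (p.1.1 + w p) (q.1.1 + w q) ≤ dist (p.1.1 - w p) (q.1.1 - w q) := by
    have hinner : inner ℝ (p.1.1 - q.1.1) (w p - w q) ≤ 0 := by
      rw [show w p - w q = -(lam • (p.1.2 - q.1.2)) by simp only [w]; module, inner_neg_right,
        real_inner_smul_right]
      exact neg_nonpos.2 (mul_nonneg hlam.le (hT.1 q q.2 p p.2))
    rw [dist_eq_norm, dist_eq_norm, add_sub_add_comm, sub_sub_sub_comm p.1.1]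
    exact norm_add_le_norm_sub_iff_inner_nonpos.2 hinner
  obtain ⟨z, hz⟩ := exists_forall_dist_le_dist hnonexpansive 0
  refine ⟨(1 / 2 : ℝ) • z, (mem_opInverse_idAddSMulOp_iff hlam.ne').2 <|
    hT.mem_of_forall_inner_nonneg fun p hp => ?_⟩
  set x := (1 / 2 : ℝ) • z with hx
  have hinner : inner ℝ (x - p.1) (x - w ⟨p, hp⟩) ≤ 0 := by
    rw [← norm_add_le_norm_sub_iff_inner_nonpos,
      show (x - p.1) + (x - w ⟨p, hp⟩) = z - (p.1 + w ⟨p, hp⟩) by rw [hx]; module,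
      show (x - p.1) - (x - w ⟨p, hp⟩) = 0 - (p.1 - w ⟨p, hp⟩) by module,
      ← dist_eq_norm, ← dist_eq_norm]
    exact hz ⟨p, hp⟩
  rw [show lam⁻¹ • (u - x) - p.2 = -(lam⁻¹ • (x - w ⟨p, hp⟩)) by
      simp only [w, smul_sub, inv_smul_smul₀ hlam.ne']; abel,
    inner_neg_right, real_inner_smul_right]
  exact neg_nonneg.2 (mul_nonpos_of_nonneg_of_nonpos (inv_nonneg.2 hlam.le) hinner)

theorem IsMonotoneOp.norm_sub_sq_le_inner (hT : IsMonotoneOp T) (hlam : 0 ≤ lam) {u u' x x' : E}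
    (hx : x ∈ opInverse (idAddSMulOp lam T) u) (hx' : x' ∈ opInverse (idAddSMulOp lam T) u') :
    ‖x - x'‖ ^ 2 ≤ inner ℝ (x - x') (u - u') := by
  obtain ⟨v, hv, rfl⟩ := hx
  obtain ⟨v', hv', rfl⟩ := hx'
  rw [add_sub_add_comm, ← smul_sub, inner_add_right, real_inner_smul_right,
    real_inner_self_eq_norm_sq]
  exact le_add_of_nonneg_right (mul_nonneg hlam (hT (x', v') hv' (x, v) hv))

theorem IsMonotoneOp.subsingleton_opInverse_idAddSMulOp (hT : IsMonotoneOp T) (hlam : 0 ≤ lam)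
    (u : E) : (opInverse (idAddSMulOp lam T) u).Subsingleton := fun x hx y hy => by
  have h := hT.norm_sub_sq_le_inner hlam hx hy
  rw [sub_self, inner_zero_right] at h
  exact sub_eq_zero.1 (norm_eq_zero.1 (sq_nonpos_iff _ |>.1 h))

variable [ProperSpace E]

theorem IsMaximalMonotoneOp.resolventMap_mem (hT : IsMaximalMonotoneOp T) (hlam : 0 < lam) (u : E) :
    resolventMap lam T u ∈ opInverse (idAddSMulOp lam T) u :=
  Classical.epsilon_spec (hT.nonempty_opInverse_idAddSMulOp hlam u)

theorem IsMaximalMonotoneOp.isFixedPt_resolventMap_iff (hT : IsMaximalMonotoneOp T)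
    (hlam : 0 < lam) {x : E} : Function.IsFixedPt (resolventMap lam T) x ↔ 0 ∈ T x := by
  have hx : x ∈ opInverse (idAddSMulOp lam T) x ↔ 0 ∈ T x := by
    simp [mem_opInverse_idAddSMulOp_iff hlam.ne']
  rw [← hx]
  refine ⟨fun h => ?_, fun h => ?_⟩
  · simpa only [h.eq] using hT.resolventMap_mem hlam x
  · exact hT.1.subsingleton_opInverse_idAddSMulOp hlam.le x (hT.resolventMap_mem hlam x) h

end Resolvent

section Relaxation

/-- A map is paracontracting if it moves every point that it does not fix strictly closer to each
of its fixed points; this strictness is what forces convergence of the iteration. -/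
def IsParacontracting {E : Type*} [Dist E] (f : E → E) : Prop :=
  ∀ ⦃x z⦄, Function.IsFixedPt f z → ¬ Function.IsFixedPt f x → dist (f x) z < dist x z

variable {E : Type*} [NormedAddCommGroup E] [InnerProductSpace ℝ E] {J : E → E} {α : ℝ}

/-- Firm nonexpansiveness, the property of resolvents of monotone operators that makes their
relaxations nonexpansive. -/
def IsFirmlyNonexpansive (J : E → E) : Prop :=
  ∀ x y, ‖J x - J y‖ ^ 2 ≤ inner ℝ (J x - J y) (x - y)

theorem IsMaximalMonotoneOp.isFirmlyNonexpansive_resolventMap [ProperSpace E] {T : E → Set E}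
    (hT : IsMaximalMonotoneOp T) {lam : ℝ} (hlam : 0 < lam) :
    IsFirmlyNonexpansive (resolventMap lam T) := fun u u' =>
  hT.1.norm_sub_sq_le_inner hlam.le (hT.resolventMap_mem hlam u) (hT.resolventMap_mem hlam u')

/-- The relaxation `Id + α (J - Id)` of a map `J`, with relaxation parameter `α`. -/
def relaxation (α : ℝ) (J : E → E) (x : E) : E := x + α • (J x - x)

theorem isFixedPt_relaxation_iff (hα : α ≠ 0) {x : E} :
    Function.IsFixedPt (relaxation α J) x ↔ Function.IsFixedPt J x := by
  simp [Function.IsFixedPt, relaxation, hα, sub_eq_zero]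

theorem IsFirmlyNonexpansive.norm_relaxation_sub_sq_le (hJ : IsFirmlyNonexpansive J) (hα : 0 ≤ α)
    (x y : E) :
    ‖relaxation α J x - relaxation α J y‖ ^ 2
      ≤ ‖x - y‖ ^ 2 - α * (2 - α) * ‖(x - y) - (J x - J y)‖ ^ 2 := by
  have hdecomp : relaxation α J x - relaxation α J y
      = (x - y) - α • ((x - y) - (J x - J y)) := by
    simp only [relaxation]
    module
  have hfirm : ‖(x - y) - (J x - J y)‖ ^ 2 ≤ inner ℝ (x - y) ((x - y) - (J x - J y)) := by
    have hxy := hJ x y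
    generalize J x - J y = j at hxy ⊢
    rw [norm_sub_sq_real, inner_sub_right, real_inner_self_eq_norm_sq, real_inner_comm]
    linarith
  rw [hdecomp, norm_sub_sq_real, real_inner_smul_right, norm_smul, mul_pow, Real.norm_eq_abs,
    sq_abs]
  linarith [mul_le_mul_of_nonneg_left hfirm hα]

theorem IsFirmlyNonexpansive.lipschitzWith_relaxation (hJ : IsFirmlyNonexpansive J)
    (hα : α ∈ Set.Icc (0 : ℝ) 2) : LipschitzWith 1 (relaxation α J) := by
  refine LipschitzWith.of_dist_le_mul fun x y => ?_
  rw [NNReal.coe_one, one_mul, dist_eq_norm, dist_eq_norm]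
  have hgap : 0 ≤ α * (2 - α) * ‖(x - y) - (J x - J y)‖ ^ 2 :=
    mul_nonneg (mul_nonneg hα.1 (sub_nonneg.2 hα.2)) (sq_nonneg _)
  exact le_of_sq_le_sq (by linarith [hJ.norm_relaxation_sub_sq_le hα.1 x y]) (norm_nonneg _)

theorem IsFirmlyNonexpansive.isParacontracting_relaxation (hJ : IsFirmlyNonexpansive J)
    (hα : α ∈ Set.Ioo (0 : ℝ) 2) : IsParacontracting (relaxation α J) := by
  intro x z hz hx
  have hJz : J z = z := (isFixedPt_relaxation_iff hα.1.ne').1 hz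
  have hJx : x - J x ≠ 0 := fun h =>
    hx ((isFixedPt_relaxation_iff hα.1.ne').2 (sub_eq_zero.1 h).symm)
  have hle := hJ.norm_relaxation_sub_sq_le hα.1.le x z
  rw [hz, hJz, sub_sub_sub_cancel_right] at hle
  have hgap : 0 < α * (2 - α) * ‖x - J x‖ ^ 2 :=
    mul_pos (mul_pos hα.1 (sub_pos.2 hα.2)) (pow_pos (norm_pos_iff.2 hJx) 2)
  rw [dist_eq_norm, dist_eq_norm]
  exact lt_of_pow_lt_pow_left₀ 2 (norm_nonneg _) (by linarith)

end Relaxation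

section Iteration

/-- The nonautonomous iteration `f (n - 1) ∘ ⋯ ∘ f 0` of a sequence of self-maps. -/
def iterateSeq {E : Type*} (f : ℕ → E → E) : ℕ → E → E
  | 0 => id
  | n + 1 => f n ∘ iterateSeq f n

theorem iterateSeq_add {E : Type*} (f : ℕ → E → E) (m n : ℕ) (x : E) :
    iterateSeq f (m + n) x = iterateSeq (fun j => f (m + j)) n (iterateSeq f m x) := by
  induction n with
  | zero => rfl
  | succ n ih => exact congrArg (f (m + n)) ih

theorem iterateSeq_eq_self {E : Type*} {f : ℕ → E → E} {n : ℕ} {x : E}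
    (h : ∀ j < n, Function.IsFixedPt (f j) x) : iterateSeq f n x = x := by
  induction n with
  | zero => rfl
  | succ n ih =>
    exact (congrArg (f n) (ih fun j hj => h j (Nat.lt_succ_of_lt hj))).trans (h n n.lt_succ_self)

variable {E : Type*} [PseudoMetricSpace E] {f : ℕ → E → E} {x z : E}

theorem lipschitzWith_iterateSeq (hf : ∀ n, LipschitzWith 1 (f n)) :
    ∀ n, LipschitzWith 1 (iterateSeq f n)
  | 0 => LipschitzWith.id
  | n + 1 => one_mul (1 : NNReal) ▸ (hf n).comp (lipschitzWith_iterateSeq hf n)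

theorem antitone_dist_iterateSeq (hf : ∀ n, LipschitzWith 1 (f n))
    (hz : ∀ n, Function.IsFixedPt (f n) z) (x : E) :
    Antitone fun n => dist (iterateSeq f n x) z :=
  antitone_nat_of_succ_le fun n => by
    simpa [iterateSeq, (hz n).eq] using (hf n).dist_le_mul (iterateSeq f n x) z

/-- The infimum over time of the distance from the orbit of `x` to `z`, which is the limit of that
distance when the maps are nonexpansive and fix `z`. -/
noncomputable def limitDist (f : ℕ → E → E) (z x : E) : ℝ := ⨅ n, dist (iterateSeq f n x) z

theorem limitDist_le_dist (f : ℕ → E → E) (z x : E) (n : ℕ) :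
    limitDist f z x ≤ dist (iterateSeq f n x) z :=
  ciInf_le ⟨0, Set.forall_mem_range.2 fun _ => dist_nonneg⟩ n

theorem lipschitzWith_limitDist (hf : ∀ n, LipschitzWith 1 (f n)) (z : E) :
    LipschitzWith 1 (limitDist f z) := by
  refine LipschitzWith.of_le_add fun x y => sub_le_iff_le_add.1 <| le_ciInf fun n => ?_
  have hxy : dist (iterateSeq f n x) (iterateSeq f n y) ≤ dist x y := by
    simpa using (lipschitzWith_iterateSeq hf n).dist_le_mul x y
  linarith [limitDist_le_dist f z x n, dist_triangle (iterateSeq f n x) (iterateSeq f n y) z]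

theorem tendsto_dist_iterateSeq (hf : ∀ n, LipschitzWith 1 (f n))
    (hz : ∀ n, Function.IsFixedPt (f n) z) (x : E) :
    Tendsto (fun n => dist (iterateSeq f n x) z) atTop (𝓝 (limitDist f z x)) :=
  tendsto_atTop_ciInf (antitone_dist_iterateSeq hf hz x)
    ⟨0, Set.forall_mem_range.2 fun _ => dist_nonneg⟩

theorem limitDist_iterateSeq (hf : ∀ n, LipschitzWith 1 (f n))
    (hz : ∀ n, Function.IsFixedPt (f n) z) (x : E) (m : ℕ) :
    limitDist (fun j => f (m + j)) z (iterateSeq f m x) = limitDist f z x := by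
  refine tendsto_nhds_unique
    (tendsto_dist_iterateSeq (fun j => hf (m + j)) (fun j => hz (m + j)) (iterateSeq f m x)) ?_
  refine ((tendsto_add_atTop_iff_nat m).2 (tendsto_dist_iterateSeq hf hz x)).congr fun n => ?_
  rw [add_comm n, iterateSeq_add]

theorem limitDist_lt_dist (hf : ∀ n, IsParacontracting (f n))
    (hz : ∀ n, Function.IsFixedPt (f n) z) (hx : ∃ n, ¬ Function.IsFixedPt (f n) x) :
    limitDist f z x < dist x z := by
  classical
  have hfirst : iterateSeq f (Nat.find hx) x = x :=
    iterateSeq_eq_self fun j hj => not_not.1 (Nat.find_min hx hj)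
  calc limitDist f z x ≤ dist (f (Nat.find hx) (iterateSeq f (Nat.find hx) x)) z :=
        limitDist_le_dist f z x (Nat.find hx + 1)
    _ = dist (f (Nat.find hx) x) z := by rw [hfirst]
    _ < dist x z := hf _ (hz _) (Nat.find_spec hx)

theorem exists_mem_tendsto_of_antitone_dist [CompleteSpace E] {Z : Set E} (hZ : IsClosed Z)
    (hne : Z.Nonempty) {u : ℕ → E} (hu : ∀ z ∈ Z, Antitone fun n => dist (u n) z)
    (h : ∀ ε > 0, ∃ n, Metric.infDist (u n) Z < ε) : ∃ x ∈ Z, Tendsto u atTop (𝓝 x) := by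
  have hcauchy : CauchySeq u := Metric.cauchySeq_iff'.2 fun ε hε => by
    obtain ⟨N, hN⟩ := h (ε / 2) (half_pos hε)
    obtain ⟨z, hz, hNz⟩ := (Metric.infDist_lt_iff hne).1 hN
    refine ⟨N, fun n hn => ?_⟩
    linarith [dist_triangle_right (u n) (u N) z, hu z hz hn]
  obtain ⟨x, hx⟩ := cauchySeq_tendsto_of_complete hcauchy
  refine ⟨x, hZ.closure_subset (Metric.mem_closure_iff.2 fun ε hε => ?_), hx⟩
  obtain ⟨N, hN⟩ := h ε hε
  obtain ⟨z, hz, hNz⟩ := (Metric.infDist_lt_iff hne).1 hN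
  exact ⟨z, hz, ((hu z hz).le_of_tendsto (hx.dist tendsto_const_nhds) N).trans_lt hNz⟩

end Iteration

section Recurrence

variable {S X : Type*} [MeasurableSpace S] {μ : Measure S} {φ : S → S}

theorem ae_forall_iterate (hφ : MeasurePreserving φ μ μ) {p : S → Prop} (h : ∀ᵐ s ∂μ, p s) :
    ∀ᵐ s ∂μ, ∀ n, p (φ^[n] s) :=
  ae_all_iff.2 fun n => (hφ.iterate n).quasiMeasurePreserving.ae h

theorem ae_of_forall_iterate_mem [IsFiniteMeasure μ] (hφ : Ergodic φ μ) {A : Set S}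
    (hA : MeasurableSet A) : ∀ᵐ s ∂μ, (∀ n, φ^[n] s ∈ A) → ∀ᵐ t ∂μ, t ∈ A := by
  let B : Set S := ⋂ n, φ^[n] ⁻¹' A
  have hB : MeasurableSet B := .iInter fun n => hφ.measurable.iterate n hA
  have hBφ : B ⊆ φ ⁻¹' B := fun s hs =>
    Set.mem_iInter.2 fun n => Set.mem_iInter.1 hs (n + 1)
  rcases hφ.ae_empty_or_univ_of_ae_le_preimage hB.nullMeasurableSet hBφ.eventuallyLE
    with hempty | huniv
  · filter_upwards [eventuallyEq_empty.1 hempty] with s hs hsA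
    exact absurd (Set.mem_iInter.2 hsA) hs
  · exact .of_forall fun _ _ =>
      huniv.mem_iff.mono fun t ht => Set.mem_iInter.1 (ht.2 (Set.mem_univ t)) 0

theorem ae_le_of_forall_iterate_le [IsFiniteMeasure μ] (hφ : Ergodic φ μ) {h : S → ℝ}
    (hh : Measurable h) : ∀ᵐ s ∂μ, ∀ C, (∀ n, h (φ^[n] s) ≤ C) → ∀ᵐ t ∂μ, h t ≤ C := by
  have hrat : ∀ᵐ s ∂μ, ∀ q : ℚ, (∀ n, h (φ^[n] s) ≤ q) → ∀ᵐ t ∂μ, h t ≤ q :=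
    ae_all_iff.2 fun q => ae_of_forall_iterate_mem hφ (measurableSet_le hh measurable_const)
  filter_upwards [hrat] with s hs C hC
  have hC_lt : ∀ᵐ t ∂μ, ∀ q : ℚ, C < q → h t ≤ q :=
    ae_all_iff.2 fun q => eventually_imp_distrib_left.2 fun hq =>
      hs q fun n => (hC n).trans hq.le
  exact hC_lt.mono fun t ht => le_of_forall_lt_rat_imp_le ht

variable [PseudoMetricSpace X] {K : Set X} {g : S → X → ℝ}

theorem measurableSet_forall_mem_le (hK : TopologicalSpace.IsSeparable K)
    (hcont : ∀ s, Continuous (g s)) (hmeas : ∀ x, Measurable fun s => g s x) (c : ℝ) :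
    MeasurableSet {s | ∀ x ∈ K, c ≤ g s x} := by
  obtain ⟨D, hDK, hD, hKD⟩ := hK.exists_countable_dense_subset
  have heq : {s | ∀ x ∈ K, c ≤ g s x} = ⋂ x ∈ D, {s | c ≤ g s x} :=
    Set.Subset.antisymm (fun s hs => Set.mem_iInter₂.2 fun x hx => hs x (hDK hx)) fun s hs x hx =>
      closure_minimal (Set.mem_iInter₂.1 hs) (isClosed_le continuous_const (hcont s)) (hKD hx)
  rw [heq]
  exact .biInter hD fun x _ => measurableSet_le measurable_const (hmeas x)

theorem ae_exists_pos_frequently_forall_mem_le (hφ : Conservative φ μ) (hK : IsCompact K)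
    (hcont : ∀ s, Continuous (g s)) (hmeas : ∀ x, Measurable fun s => g s x)
    (hpos : ∀ᵐ s ∂μ, ∀ x ∈ K, 0 < g s x) :
    ∀ᵐ s ∂μ, ∃ c > 0, ∃ᶠ n in atTop, ∀ x ∈ K, c ≤ g (φ^[n] s) x := by
  have hrecurrent : ∀ᵐ s ∂μ, ∀ m : ℕ, (∀ x ∈ K, 1 / ((m : ℝ) + 1) ≤ g s x) →
      ∃ᶠ n in atTop, ∀ x ∈ K, 1 / ((m : ℝ) + 1) ≤ g (φ^[n] s) x :=
    ae_all_iff.2 fun m => hφ.ae_mem_imp_frequently_image_mem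
      (measurableSet_forall_mem_le hK.isSeparable hcont hmeas _).nullMeasurableSet
  filter_upwards [hrecurrent, hpos] with s hs hs_pos
  obtain ⟨c, hc, hcK⟩ := hK.exists_forall_le' (hcont s).continuousOn hs_pos
  obtain ⟨m, hm⟩ := exists_nat_one_div_lt hc
  exact ⟨_, Nat.one_div_pos_of_nat, hs m fun x hx => hm.le.trans (hcK x hx)⟩

end Recurrence

section RandomIteration

/-- The points fixed by almost every member of a family of maps, the limits of its random
iteration. -/
def aeFixedPoints {S E : Type*} [MeasurableSpace S] (μ : Measure S) (R : S → E → E) : Set E :=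
  {x | ∀ᵐ s ∂μ, Function.IsFixedPt (R s) x}

variable {S E : Type*} [MeasurableSpace S] {μ : Measure S} {φ : S → S} {R : S → E → E}

theorem measurable_iterateSeq [MeasurableSpace E] (hR : Measurable (Function.uncurry R))
    {Ω : Type*} [MeasurableSpace Ω] {ξ : ℕ → Ω → S} (hξ : ∀ n, Measurable (ξ n)) {Y : Ω → E}
    (hY : Measurable Y) : ∀ n, Measurable fun ω => iterateSeq (fun j => R (ξ j ω)) n (Y ω)
  | 0 => hY
  | n + 1 => hR.comp ((hξ n).prodMk (measurable_iterateSeq hR hξ hY n))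

theorem ae_closure_aeFixedPoints_subset [TopologicalSpace E]
    [TopologicalSpace.MetrizableSpace E] [TopologicalSpace.SeparableSpace E]
    (hR : ∀ s, Continuous (R s)) :
    ∀ᵐ s ∂μ, closure (aeFixedPoints μ R) ⊆ Function.fixedPoints (R s) := by
  obtain ⟨D, hDZ, hD, hZD⟩ := (TopologicalSpace.IsSeparable.of_separableSpace
    (aeFixedPoints μ R)).exists_countable_dense_subset
  filter_upwards [(ae_ball_iff hD).2 fun z hz => hDZ hz] with s hs
  exact closure_minimal (hZD.trans (closure_minimal hs (isClosed_fixedPoints (hR s))))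
    (isClosed_fixedPoints (hR s))

theorem isClosed_aeFixedPoints [TopologicalSpace E]
    [TopologicalSpace.MetrizableSpace E] [TopologicalSpace.SeparableSpace E]
    (hR : ∀ s, Continuous (R s)) : IsClosed (aeFixedPoints μ R) :=
  isClosed_of_closure_subset fun _ hx => (ae_closure_aeFixedPoints_subset hR).mono fun _ hs => hs hx

variable [MetricSpace E] [MeasurableSpace E] [BorelSpace E]

theorem ae_mem_aeFixedPoints_of_forall_iterate [SecondCountableTopology E] [IsFiniteMeasure μ]
    (hφ : Ergodic φ μ) (hR : ∀ s, LipschitzWith 1 (R s))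
    (hmeas : ∀ x, Measurable fun s => R s x) :
    ∀ᵐ s ∂μ, ∀ x, (∀ n, Function.IsFixedPt (R (φ^[n] s)) x) → x ∈ aeFixedPoints μ R := by
  obtain ⟨D, hD, hD_dense⟩ := TopologicalSpace.exists_countable_dense E
  have hdisplacement : ∀ᵐ s ∂μ, ∀ q ∈ D, ∀ C, (∀ n, dist (R (φ^[n] s) q) q ≤ C) →
      ∀ᵐ t ∂μ, dist (R t q) q ≤ C :=
    (ae_ball_iff hD).2 fun q _ => ae_le_of_forall_iterate_le hφ ((hmeas q).dist measurable_const)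
  filter_upwards [hdisplacement] with s hs x hx
  have hbound (q : E) (n : ℕ) : dist (R (φ^[n] s) q) q ≤ 2 * dist q x := by
    have hqx : dist (R (φ^[n] s) q) x ≤ dist q x := by
      simpa [(hx n).eq] using (hR (φ^[n] s)).dist_le_mul q x
    linarith [dist_triangle_right (R (φ^[n] s) q) q x]
  have hdense : ∀ᵐ t ∂μ, ∀ q ∈ D, dist (R t q) q ≤ 2 * dist q x :=
    (ae_ball_iff hD).2 fun q hq => hs q hq _ (hbound q)
  filter_upwards [hdense] with t ht
  have hclosed : IsClosed {q | dist (R t q) q ≤ 2 * dist q x} :=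
    isClosed_le ((hR t).continuous.dist continuous_id) (by fun_prop)
  have hx_le : dist (R t x) x ≤ 2 * dist x x := closure_minimal ht hclosed (hD_dense x)
  exact dist_le_zero.1 (by simpa using hx_le)

theorem ae_forall_exists_iterateSeq_notMem [IsFiniteMeasure μ]
    (hφ : MeasurePreserving φ μ μ) (hR : ∀ s, LipschitzWith 1 (R s))
    (hpara : ∀ s, IsParacontracting (R s)) (hmeas : Measurable (Function.uncurry R)) {z : E}
    (hz : z ∈ aeFixedPoints μ R) {K : Set E} (hK : IsCompact K)
    (hmoved : ∀ᵐ s ∂μ, ∀ x ∈ K, ∃ n, ¬ Function.IsFixedPt (R (φ^[n] s)) x) :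
    ∀ᵐ s ∂μ, ∀ x, ∃ n, iterateSeq (fun j => R (φ^[j] s)) n x ∉ K := by
  let drop (s : S) (x : E) : ℝ := dist x z - limitDist (fun j => R (φ^[j] s)) z x
  have hcont (s) : Continuous (drop s) :=
    (continuous_id.dist continuous_const).sub (lipschitzWith_limitDist (fun _ => hR _) z).continuous
  have hdrop_meas (x) : Measurable fun s => drop s x :=
    measurable_const.sub <| .iInf fun n =>
      (continuous_id.dist continuous_const).measurable.comp
        (measurable_iterateSeq hmeas (fun j => hφ.measurable.iterate j) measurable_const n)
  have hfixed : ∀ᵐ s ∂μ, ∀ n, Function.IsFixedPt (R (φ^[n] s)) z := ae_forall_iterate hφ hz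
  have hpos : ∀ᵐ s ∂μ, ∀ x ∈ K, 0 < drop s x := by
    filter_upwards [hfixed, hmoved] with s hs hsK x hx
    exact sub_pos.2 (limitDist_lt_dist (fun _ => hpara _) hs (hsK x hx))
  -- By recurrence, an orbit staying in `K` would see its distance to `z` exceed its limit by `c`
  -- infinitely often.
  filter_upwards [hfixed, ae_exists_pos_frequently_forall_mem_le hφ.conservative hK hcont
    hdrop_meas hpos] with s hs ⟨c, hc, hfreq⟩ x
  by_contra! hx
  have hdrop_tendsto : Tendsto (fun n => drop (φ^[n] s) (iterateSeq (fun j => R (φ^[j] s)) n x))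
      atTop (𝓝 0) := by
    have hdrop (n) : drop (φ^[n] s) (iterateSeq (fun j => R (φ^[j] s)) n x)
        = dist (iterateSeq (fun j => R (φ^[j] s)) n x) z
          - limitDist (fun j => R (φ^[j] s)) z x := by
      rw [← limitDist_iterateSeq (fun _ => hR _) hs x n]
      simp only [drop, ← Function.iterate_add_apply, add_comm n]
    simp only [hdrop]
    exact tendsto_sub_nhds_zero_iff.2 (tendsto_dist_iterateSeq (fun j => hR (φ^[j] s)) hs x)
  obtain ⟨n, hn, hn_lt⟩ := (hfreq.and_eventually (hdrop_tendsto.eventually_lt_const hc)).exists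
  exact (hn _ (hx n)).not_gt hn_lt

theorem ae_forall_exists_infDist_iterateSeq_lt [ProperSpace E] [IsFiniteMeasure μ]
    (hφ : Ergodic φ μ) (hR : ∀ s, LipschitzWith 1 (R s)) (hpara : ∀ s, IsParacontracting (R s))
    (hmeas : Measurable (Function.uncurry R)) (hne : (aeFixedPoints μ R).Nonempty) :
    ∀ᵐ s ∂μ, ∀ x, ∀ ε > 0,
      ∃ n, Metric.infDist (iterateSeq (fun j => R (φ^[j] s)) n x) (aeFixedPoints μ R) < ε := by
  obtain ⟨z, hz⟩ := hne
  let K (m : ℕ) : Set E :=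
    Metric.closedBall z m ∩ {x | 1 / ((m : ℝ) + 1) ≤ Metric.infDist x (aeFixedPoints μ R)}
  have hK_compact (m) : IsCompact (K m) :=
    (isCompact_closedBall _ _).inter_right
      (isClosed_le continuous_const (Metric.continuous_infDist_pt _))
  have hK_disjoint (m) : Disjoint (K m) (aeFixedPoints μ R) :=
    Set.disjoint_left.2 fun x hx hxZ =>
      not_le_of_gt (Metric.infDist_zero_of_mem hxZ ▸ Nat.one_div_pos_of_nat) hx.2
  have hescape (m) : ∀ᵐ s ∂μ, ∀ x, ∃ n, iterateSeq (fun j => R (φ^[j] s)) n x ∉ K m := by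
    refine ae_forall_exists_iterateSeq_notMem hφ.toMeasurePreserving hR hpara hmeas hz
      (hK_compact m) ?_
    filter_upwards [ae_mem_aeFixedPoints_of_forall_iterate hφ hR fun x =>
      hmeas.comp measurable_prodMk_right] with s hs x hx
    exact not_forall.1 fun h => Set.disjoint_left.1 (hK_disjoint m) hx (hs x h)
  filter_upwards [ae_forall_iterate hφ.toMeasurePreserving hz, ae_all_iff.2 hescape]
    with s hs hs_escape x ε hε
  obtain ⟨m, hm_dist, hm_lt⟩ : ∃ m : ℕ, dist x z ≤ m ∧ 1 / ((m : ℝ) + 1) < ε :=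
    ((tendsto_natCast_atTop_atTop.eventually_ge_atTop _).and
      (tendsto_one_div_add_atTop_nhds_zero_nat.eventually_lt_const hε)).exists
  obtain ⟨n, hn⟩ := hs_escape m x
  refine ⟨n, lt_of_not_ge fun h => hn ⟨?_, hm_lt.le.trans h⟩⟩
  exact (antitone_dist_iterateSeq (fun j => hR (φ^[j] s)) hs x n.zero_le).trans hm_dist

theorem ae_forall_exists_tendsto_iterateSeq [ProperSpace E] [IsFiniteMeasure μ]
    (hφ : Ergodic φ μ) (hR : ∀ s, LipschitzWith 1 (R s)) (hpara : ∀ s, IsParacontracting (R s))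
    (hmeas : Measurable (Function.uncurry R)) (hne : (aeFixedPoints μ R).Nonempty) :
    ∀ᵐ s ∂μ, ∀ x, ∃ z ∈ aeFixedPoints μ R,
      Tendsto (fun n => iterateSeq (fun j => R (φ^[j] s)) n x) atTop (𝓝 z) := by
  have hcont (s) : Continuous (R s) := (hR s).continuous
  have hfixed : ∀ᵐ s ∂μ, ∀ n, closure (aeFixedPoints μ R) ⊆ Function.fixedPoints (R (φ^[n] s)) :=
    ae_forall_iterate hφ.toMeasurePreserving (ae_closure_aeFixedPoints_subset hcont)
  filter_upwards [hfixed, ae_forall_exists_infDist_iterateSeq_lt hφ hR hpara hmeas hne]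
    with s hs hs_infDist x
  exact exists_mem_tendsto_of_antitone_dist (isClosed_aeFixedPoints hcont) hne
    (fun z hz => antitone_dist_iterateSeq (fun j => hR (φ^[j] s))
      (fun n => hs n (subset_closure hz)) x) (hs_infDist x)

end RandomIteration

theorem exists_measurable_forall_mem_ae_tendsto {Ω E : Type*} [MeasurableSpace Ω] {P : Measure Ω}
    [TopologicalSpace E] [TopologicalSpace.MetrizableSpace E] [SecondCountableTopology E]
    [MeasurableSpace E] [BorelSpace E] {u : ℕ → Ω → E} (hu : ∀ n, Measurable (u n)) {Z : Set E}
    (hZ : MeasurableSet Z) (hne : Z.Nonempty)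
    (h : ∀ᵐ ω ∂P, ∃ z ∈ Z, Tendsto (fun n => u n ω) atTop (𝓝 z)) :
    ∃ y : Ω → E, Measurable y ∧ (∀ ω, y ω ∈ Z) ∧
      ∀ᵐ ω ∂P, Tendsto (fun n => u n ω) atTop (𝓝 (y ω)) := by
  obtain ⟨l, hl_meas, hl⟩ := measurable_limit_of_tendsto_metrizable_ae
    (fun n => (hu n).aemeasurable) (h.mono fun ω ⟨z, _, hz⟩ => ⟨z, hz⟩)
  have hl_mem : ∀ᵐ ω ∂P, l ω ∈ Z := by
    filter_upwards [h, hl] with ω ⟨z, hz, hωz⟩ hω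
    rwa [tendsto_nhds_unique hω hωz]
  obtain ⟨y, hy_meas, hy_mem, hly⟩ :=
    hl_meas.aestronglyMeasurable.exists_stronglyMeasurable_range_subset hZ hne hl_mem
  refine ⟨y, hy_meas.measurable, hy_mem, ?_⟩
  filter_upwards [hl, hly] with ω hω hly
  rwa [← hly]

section ErgodicStationary

theorem seqShift_iterate_zero {I : Type*} (n : ℕ) (w : ℕ → I) : seqShift^[n] w 0 = w n := by
  induction n generalizing w with
  | zero => rfl
  | succ _ ih => exact ih (seqShift w)

variable {Ω I E : Type*} [MeasurableSpace Ω] [MeasurableSpace I] {P : Measure Ω}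
  [MeasurableSpace E] {R : I → E → E}

theorem aeFixedPoints_map [MeasurableSingletonClass E] (hR : ∀ x, Measurable fun i => R i x)
    {f : Ω → I} (hf : Measurable f) :
    aeFixedPoints (P.map f) R = aeFixedPoints P fun ω => R (f ω) :=
  Set.ext fun x => ae_map_iff hf.aemeasurable (hR x (measurableSet_singleton x))

theorem IsErgodicStationary.ae_forall_exists_tendsto [IsFiniteMeasure P] {ξ : ℕ → Ω → I}
    (hξ : IsErgodicStationary ξ P) [MetricSpace E] [ProperSpace E] [BorelSpace E]
    (hR : ∀ i, LipschitzWith 1 (R i)) (hpara : ∀ i, IsParacontracting (R i))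
    (hmeas : Measurable (Function.uncurry R)) (hne : (aeFixedPoints (P.map (ξ 0)) R).Nonempty) :
    ∀ᵐ ω ∂P, ∀ x, ∃ z ∈ aeFixedPoints (P.map (ξ 0)) R,
      Tendsto (fun n => iterateSeq (fun j => R (ξ j ω)) n x) atTop (𝓝 z) := by
  have hpath : Measurable fun ω n => ξ n ω := measurable_pi_iff.2 hξ.measurable
  have hlaw : P.map (ξ 0) = (P.map fun ω n => ξ n ω).map fun w => w 0 :=
    (Measure.map_map (measurable_pi_apply 0) hpath).symm
  rw [hlaw, aeFixedPoints_map (R := R) (fun _ => hmeas.comp measurable_prodMk_right)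
    (measurable_pi_apply 0)] at hne ⊢
  have hmeas_path : Measurable (Function.uncurry fun w : ℕ → I => R (w 0)) :=
    hmeas.comp (f := fun q : (ℕ → I) × E => (q.1 0, q.2)) (by fun_prop)
  have h := ae_forall_exists_tendsto_iterateSeq hξ.ergodic (fun w => hR (w 0))
    (fun w => hpara (w 0)) hmeas_path hne
  simp only [seqShift_iterate_zero] at h
  exact ae_of_ae_map hpath.aemeasurable h

end ErgodicStationary

section Proximal

variable {I E : Type*} [MeasurableSpace I] [NormedAddCommGroup E] [InnerProductSpace ℝ E]
  {T : I → E → Set E} {lam α : ℝ}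

theorem aeFixedPoints_relaxation_resolventMap [ProperSpace E] (hT : ∀ i, IsMaximalMonotoneOp (T i))
    (hlam : 0 < lam) (hα : α ≠ 0) (ν : Measure I) :
    aeFixedPoints ν (fun i => relaxation α (resolventMap lam (T i))) = aeCommonZeros ν T := by
  simp only [aeFixedPoints, aeCommonZeros, isFixedPt_relaxation_iff hα,
    (hT _).isFixedPt_resolventMap_iff hlam]

theorem measurable_uncurry_relaxation [SecondCountableTopology E] [MeasurableSpace E]
    [BorelSpace E] {J : I → E → E} (hJ : ∀ i, Continuous (relaxation α (J i)))
    (hmeas : ∀ x, Measurable fun i => J i x) :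
    Measurable (Function.uncurry fun i => relaxation α (J i)) :=
  (measurable_uncurry_of_continuous_of_measurable hJ fun x =>
    measurable_const.add (((hmeas x).sub measurable_const).const_smul α)).comp measurable_swap

end Proximal

theorem mainTheorem3_general {E : Type*} [NormedAddCommGroup E] [InnerProductSpace ℝ E]
    [ProperSpace E] [MeasurableSpace E] [BorelSpace E]
    {I : Type*} [MeasurableSpace I] {ν : Measure I}
    {Ω : Type*} [MeasurableSpace Ω] {P : Measure Ω} [IsFiniteMeasure P]
    {T : I → E → Set E} (hT : ∀ i, IsMaximalMonotoneOp (T i))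
    {lam : ℝ} (hlam : 0 < lam) {α : ℝ} (hα : α ∈ Set.Ioo (0 : ℝ) 2)
    (hmeas : ∀ x, Measurable fun i => resolventMap lam (T i) x)
    {ξ : ℕ → Ω → I} (hξ : IsErgodicStationary ξ P) (hν : P.map (ξ 0) = ν)
    (hZ : (aeCommonZeros ν T).Nonempty)
    {X : ℕ → Ω → E} (hX0 : Measurable (X 0))
    (hX : ∀ n ω, X (n + 1) ω
      = X n ω + α • (resolventMap lam (T (ξ n ω)) (X n ω) - X n ω)) :
    (∀ n, Measurable (X n)) ∧
      ∃ Xlim : Ω → E, Measurable Xlim ∧ (∀ ω, Xlim ω ∈ aeCommonZeros ν T) ∧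
        ∀ᵐ ω ∂P, Tendsto (fun n => X n ω) atTop (𝓝 (Xlim ω)) := by
  let R (i : I) : E → E := relaxation α (resolventMap lam (T i))
  have hfirm (i) := (hT i).isFirmlyNonexpansive_resolventMap hlam
  have hR (i) : LipschitzWith 1 (R i) := (hfirm i).lipschitzWith_relaxation ⟨hα.1.le, hα.2.le⟩
  have hR_meas : Measurable (Function.uncurry R) :=
    measurable_uncurry_relaxation (fun i => (hR i).continuous) hmeas
  have hX_eq : X = fun n ω => iterateSeq (fun j => R (ξ j ω)) n (X 0 ω) := by
    ext n ω
    induction n with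
    | zero => rfl
    | succ n ih => exact (hX n ω).trans (congrArg (R (ξ n ω)) ih)
  have hX_meas (n) : Measurable (X n) :=
    hX_eq ▸ measurable_iterateSeq hR_meas hξ.measurable hX0 n
  subst hν
  rw [← aeFixedPoints_relaxation_resolventMap hT hlam hα.1.ne'] at hZ ⊢
  refine ⟨hX_meas, exists_measurable_forall_mem_ae_tendsto hX_meas
    (isClosed_aeFixedPoints fun i => (hR i).continuous).measurableSet hZ ?_⟩
  filter_upwards [hξ.ae_forall_exists_tendsto hR
    (fun i => (hfirm i).isParacontracting_relaxation hα) hR_meas hZ] with ω hω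
  rw [hX_eq]
  exact hω (X 0 ω)

theorem mainTheorem3 {k : ℕ}
    {I : Type*} [MeasurableSpace I] (ν : Measure I) [IsProbabilityMeasure ν]
    {Ω : Type*} [MeasurableSpace Ω] (P : Measure Ω) [IsProbabilityMeasure P]
    (T : I → EuclideanSpace ℝ (Fin k) → Set (EuclideanSpace ℝ (Fin k)))
    (hT : ∀ i, IsMaximalMonotoneOp (T i))
    (lam : ℝ) (hlam : 0 < lam) (α : ℝ) (hα : α ∈ Set.Ioo (0 : ℝ) 2)
    (hmeas : ∀ x, Measurable fun i => resolventMap lam (T i) x)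
    (ξ : ℕ → Ω → I) (hξ : IsErgodicStationary ξ P) (hν : P.map (ξ 0) = ν)
    (hZ : (aeCommonZeros ν T).Nonempty)
    (x₀ : EuclideanSpace ℝ (Fin k))
    (X : ℕ → Ω → EuclideanSpace ℝ (Fin k))
    (hX0 : ∀ ω, X 0 ω = x₀)
    (hX : ∀ n ω, X (n + 1) ω
      = X n ω + α • (resolventMap lam (T (ξ n ω)) (X n ω) - X n ω)) :
    (∀ n, Measurable (X n)) ∧
      ∃ Xlim : Ω → EuclideanSpace ℝ (Fin k),
        Measurable Xlim ∧ (∀ ω, Xlim ω ∈ aeCommonZeros ν T) ∧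
          ∀ᵐ ω ∂P, Tendsto (fun n => X n ω) atTop (𝓝 (Xlim ω)) :=
  mainTheorem3_general hT hlam hα hmeas hξ hν hZ (funext hX0 ▸ measurable_const) hX
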